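/- For a set $A\subset\mathbb{R}^d$ and an integer $k\ge 1$ let $A[k]=\{a_1+\dots+a_k : a_1,\dots,a_k\in A\}$ be the Minkowski sum of $k$ copies of $A$, let $\operatorname{vol}$ denote Lebesgue measure on $\mathbb{R}^d$, $\operatorname{conv}A$ the convex hull of $A$, and $\dim A$ the dimension of the smallest affine subspace containing $A$. A nonempty set $S\subset\mathbb{R}^d$ is called star-shaped if there is a point $p\in\mathbb{R}^d$ such that for every $q\in S$ the closed segment $[p,q]$ is contained in $S$. (i) Let $d\ge 2$ and $k\ge\max\{2,(d-1)(d-2)\}$ be integers. Then for every compact star-shaped set $S\subset\mathbb{R}^d$, $$\operatorname{vol}\left(\frac{1}{k+1}S[k+1]\right)\ \ge\ \operatorname{vol}\left(\frac1k S[k]\right),$$ with equality if and only if $\dim S<d$ or $\frac1k S[k]=\operatorname{conv}S$. (ii) In particular, the Bobkov–Madiman–Wang conjecture holds for star-shaped sets in dimensions $2$ and $3$: if $d\in\{2,3\}$ and $S\subset\mathbb{R}^d$ is compact and star-shaped, then the sequence $\left\{\operatorname{vol}\left(\frac1k S[k]\right)\right\}_{k\ge 1}$ is non-decreasing. -/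

import Mathlib

open MeasureTheory
open scoped Pointwise

/-- The Minkowski sum `A[k] = {a₁ + ⋯ + a_k : a₁, …, a_k ∈ A}` of `k` copies of `A`. -/
def minkowskiMultiple {E : Type*} [AddCommMonoid E] (A : Set E) (k : ℕ) : Set E :=
  {x | ∃ a : Fin k → E, (∀ i, a i ∈ A) ∧ x = ∑ i, a i}

/-- A nonempty set is star-shaped if for some point `p` it contains, with every point `q` of it,
the whole closed segment `[p, q]`. -/
def IsStarShaped {E : Type*} [AddCommGroup E] [Module ℝ E] (S : Set E) : Prop :=
  S.Nonempty ∧ ∃ p : E, StarConvex ℝ p S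

/-- The dimension of the affine hull of `A`. -/
noncomputable def affineDim {E : Type*} [AddCommGroup E] [Module ℝ E] (A : Set E) : ℕ :=
  Module.finrank ℝ (affineSpan ℝ A).direction

/-!
Let `K` be the convex hull of the star-shaped set `S`, with the centre of the star at the origin,
and let `A k = (1 / k) S[k]`. The proof shows that the volume deficits contract:
`vol (K \ A (k + 1)) ≤ c * vol (K \ A k)` with a constant `c < 1`. Since all `A k` lie in `K`, this
gives monotonicity, and equality forces `vol (K \ A k) = 0`. As `A k` is closed, the latter means
`A k = K` when `K` has interior points, that is, when `S` has full dimension.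

The deficit inequality is proved first inside a simplex with vertices `0, b 1, …, b d`, where
`b 1, …, b d` is a basis consisting of points of `S`
(`measure_cornerSimplex_diff_le`). In the coordinates of that basis, star-shapedness puts every
point with nonnegative coordinates and `∑ ⌈x i⌉ ≤ k` into `S[k]`, and `S[k] + b i ⊆ S[k + 1]`.
Hence a point `x` missed by `S[k + 1]` has all its translates `x - b i` with `⌊x i⌋ ≥ 1` missed by
`S[k]`. Giving the `i`-th translate the weight `⌊x i⌋ / ∑ ⌊x j⌋` and integrating, a point `y` missed
by `S[k]` receives the total weight `(N + d) / (N + 1)` with `N = ∑ ⌊y j⌋ ≥ k + 1 - d`, which is at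
most `(k + 1) / (k + 2 - d)`. After rescaling, the constant is
`c = (k + 1) / (k + 2 - d) * (k / (k + 1)) ^ d`, and `k ≥ (d - 1) (d - 2)` yields `c < 1`
(`contraction_factor_lt_one`).

To pass from simplices to `K`, the inequality is summed over a triangulation of a polytope with
vertices `0` and a finite `F ⊆ S`. If `F` is in radially general position, the facets not containing
`0` are simplices, and the cones over them from `0` tile the polytope up to null sets
(`RadiallyGeneric.exists_triangulation`). Such an `F` is obtained by moving points of `S` slightly
towards the origin, which stays inside `S`; an increasing sequence of such sets exhausts the
interior of `K` (`StarConvex.exists_monotone_radiallyGeneric`).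
-/

/-! ### Algebra of iterated Minkowski sums -/

section Minkowski

variable {E : Type*} [AddCommMonoid E] {A : Set E}

theorem minkowskiMultiple_zero : minkowskiMultiple A 0 = {0} := by
  ext x
  simp [minkowskiMultiple]

theorem minkowskiMultiple_succ (k : ℕ) :
    minkowskiMultiple A (k + 1) = minkowskiMultiple A k + A := by
  ext x
  simp only [minkowskiMultiple, Set.mem_add, Set.mem_ofPred_eq]
  constructor
  · rintro ⟨a, ha, rfl⟩
    exact ⟨_, ⟨fun i => a i.castSucc, fun i => ha _, rfl⟩, _, ha (Fin.last k),
      (Fin.sum_univ_castSucc a).symm⟩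
  · rintro ⟨_, ⟨a, ha, rfl⟩, y, hy, rfl⟩
    refine ⟨Fin.snoc (α := fun _ => E) a y, fun i => ?_, ?_⟩
    · refine Fin.lastCases ?_ (fun j => ?_) i <;> simp [hy, ha]
    · simp [Fin.sum_univ_castSucc]

theorem add_mem_minkowskiMultiple {m n : ℕ} {x y : E} (hx : x ∈ minkowskiMultiple A m)
    (hy : y ∈ minkowskiMultiple A n) : x + y ∈ minkowskiMultiple A (m + n) := by
  induction n generalizing y with
  | zero =>
    rw [minkowskiMultiple_zero, Set.mem_singleton_iff] at hy
    simpa [hy] using hx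
  | succ n ih =>
    rw [minkowskiMultiple_succ] at hy
    obtain ⟨z, hz, a, ha, rfl⟩ := hy
    rw [← add_assoc, ← add_assoc, minkowskiMultiple_succ]
    exact Set.add_mem_add (ih hz) ha

theorem sum_mem_minkowskiMultiple {ι : Type*} (s : Finset ι) {n : ι → ℕ} {x : ι → E}
    (h : ∀ i ∈ s, x i ∈ minkowskiMultiple A (n i)) :
    ∑ i ∈ s, x i ∈ minkowskiMultiple A (∑ i ∈ s, n i) := by
  classical
  induction s using Finset.induction_on with
  | empty => simp [minkowskiMultiple_zero]
  | insert a s has ih =>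
    rw [Finset.sum_insert has, Finset.sum_insert has]
    exact add_mem_minkowskiMultiple (h _ (Finset.mem_insert_self _ _))
      (ih fun i hi => h i (Finset.mem_insert_of_mem hi))

theorem nsmul_mem_minkowskiMultiple {x : E} (hx : x ∈ A) (n : ℕ) :
    n • x ∈ minkowskiMultiple A n :=
  ⟨fun _ => x, fun _ => hx, by simp⟩

theorem minkowskiMultiple_mono (h0 : (0 : E) ∈ A) {m n : ℕ} (h : m ≤ n) :
    minkowskiMultiple A m ⊆ minkowskiMultiple A n := by
  intro x hx
  obtain ⟨l, rfl⟩ := Nat.exists_eq_add_of_le h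
  have := nsmul_mem_minkowskiMultiple h0 l
  rw [nsmul_zero] at this
  simpa using add_mem_minkowskiMultiple hx this

theorem IsCompact.minkowskiMultiple [TopologicalSpace E] [ContinuousAdd E] (hA : IsCompact A)
    (k : ℕ) : IsCompact (minkowskiMultiple A k) := by
  induction k with
  | zero => rw [minkowskiMultiple_zero]; exact isCompact_singleton
  | succ k ih => rw [minkowskiMultiple_succ]; exact ih.add hA

end Minkowski

section Average

variable {E : Type*} [AddCommGroup E] [Module ℝ E] {A : Set E}

theorem average_subset_convexHull {k : ℕ} (hk : k ≠ 0) :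
    (1 / (k : ℝ)) • minkowskiMultiple A k ⊆ convexHull ℝ A := by
  rintro _ ⟨_, ⟨a, ha, rfl⟩, rfl⟩
  have hk' : (k : ℝ) ≠ 0 := Nat.cast_ne_zero.2 hk
  simp only [Finset.smul_sum]
  exact (convex_convexHull ℝ A).sum_mem (fun _ _ => by positivity) (by simp [hk'])
    fun i _ => subset_convexHull ℝ A (ha i)

theorem subset_average {k : ℕ} (hk : k ≠ 0) :
    A ⊆ (1 / (k : ℝ)) • minkowskiMultiple A k := by
  intro x hx
  have hk' : (k : ℝ) ≠ 0 := Nat.cast_ne_zero.2 hk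
  refine ⟨_, nsmul_mem_minkowskiMultiple hx k, ?_⟩
  simp [← Nat.cast_smul_eq_nsmul ℝ, smul_smul, hk']

theorem average_vadd (p : E) {k : ℕ} (hk : k ≠ 0) :
    (1 / (k : ℝ)) • minkowskiMultiple (p +ᵥ A) k
      = p +ᵥ (1 / (k : ℝ)) • minkowskiMultiple A k := by
  have hk' : (k : ℝ) ≠ 0 := Nat.cast_ne_zero.2 hk
  have key (a : Fin k → E) : (1 / (k : ℝ)) • ∑ i, (p + a i) = p + (1 / (k : ℝ)) • ∑ i, a i := by
    simp [Finset.sum_add_distrib, smul_add, ← Nat.cast_smul_eq_nsmul ℝ, smul_smul, hk']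
  ext x
  constructor
  · rintro ⟨_, ⟨a, ha, rfl⟩, rfl⟩
    choose c hc hca using ha
    refine ⟨_, ⟨_, ⟨c, hc, rfl⟩, rfl⟩, ?_⟩
    simp only [vadd_eq_add] at hca ⊢
    rw [← key c, Finset.sum_congr rfl fun i _ => hca i]
  · rintro ⟨_, ⟨_, ⟨c, hc, rfl⟩, rfl⟩, rfl⟩
    exact ⟨_, ⟨fun i => p + c i, fun i => ⟨c i, hc i, rfl⟩, rfl⟩, key c⟩

end Average

/-! ### A corner simplex in the cone of a basis -/

section CornerSimplex

variable {ι E : Type*} [Fintype ι] [NormedAddCommGroup E] [NormedSpace ℝ E]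

/-- The simplex with vertices `0` and `t • b i`, described by coordinates in the basis `b`. -/
def cornerSimplex (b : Module.Basis ι ℝ E) (t : ℝ) : Set E :=
  {x | (∀ i, 0 ≤ b.repr x i) ∧ ∑ i, b.repr x i ≤ t}

theorem continuous_repr (b : Module.Basis ι ℝ E) (i : ι) : Continuous fun x => b.repr x i := by
  have : FiniteDimensional ℝ E := b.finiteDimensional_of_finite
  exact (b.coord i).continuous_of_finiteDimensional

theorem isClosed_cornerSimplex (b : Module.Basis ι ℝ E) (t : ℝ) :
    IsClosed (cornerSimplex b t) := by
  have h := continuous_repr b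
  have hset : cornerSimplex b t
      = (⋂ i, {x | 0 ≤ b.repr x i}) ∩ {x | ∑ i, b.repr x i ≤ t} := by
    ext x; simp [cornerSimplex]
  rw [hset]
  exact (isClosed_iInter fun i => isClosed_le continuous_const (h i)).inter
    (isClosed_le (continuous_finsetSum _ fun i _ => h i) continuous_const)

theorem mem_minkowskiMultiple_of_sum_ceil_le {S : Set E} (hstar : StarConvex ℝ 0 S)
    (h0 : (0 : E) ∈ S) (b : Module.Basis ι ℝ E) (hb : ∀ i, b i ∈ S) {k : ℕ} {x : E}
    (hx : ∀ i, 0 ≤ b.repr x i) (hk : ∑ i, ⌈b.repr x i⌉₊ ≤ k) : x ∈ minkowskiMultiple S k := by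
  refine minkowskiMultiple_mono h0 hk ?_
  suffices h : ∑ i, b.repr x i • b i ∈ minkowskiMultiple S (∑ i, ⌈b.repr x i⌉₊) by
    rwa [b.sum_repr] at h
  refine sum_mem_minkowskiMultiple _ fun i _ => ?_
  set t := b.repr x i
  rcases Nat.eq_zero_or_pos ⌈t⌉₊ with h | h
  · have ht : t = 0 := le_antisymm (Nat.ceil_eq_zero.1 h) (hx i)
    simp [ht, minkowskiMultiple_zero]
  · have hpos : (0 : ℝ) < ⌈t⌉₊ := Nat.cast_pos.2 h
    have hmem : (t / ⌈t⌉₊) • b i ∈ S :=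
      hstar.smul_mem (hb i) (div_nonneg (hx i) hpos.le) (div_le_one_of_le₀ (Nat.le_ceil t) hpos.le)
    convert nsmul_mem_minkowskiMultiple hmem ⌈t⌉₊ using 1
    rw [← Nat.cast_smul_eq_nsmul ℝ, smul_smul, mul_div_cancel₀ _ hpos.ne']

theorem cornerSimplex_zero_mem (b : Module.Basis ι ℝ E) {t : ℝ} (ht : 0 ≤ t) :
    (0 : E) ∈ cornerSimplex b t := by
  simp [cornerSimplex, ht]

theorem smul_cornerSimplex (b : Module.Basis ι ℝ E) {t : ℝ} (ht : 0 < t) :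
    t • cornerSimplex b 1 = cornerSimplex b t := by
  ext x
  rw [Set.mem_smul_set_iff_inv_smul_mem₀ ht.ne']
  simp only [cornerSimplex, Set.mem_ofPred_eq, map_smul, Finsupp.smul_apply, smul_eq_mul,
    ← Finset.mul_sum]
  have ht' : 0 < t⁻¹ := inv_pos.2 ht
  simp only [mul_nonneg_iff_of_pos_left ht', inv_mul_le_iff₀ ht, mul_one]

theorem convex_cornerSimplex (b : Module.Basis ι ℝ E) (t : ℝ) :
    Convex ℝ (cornerSimplex b t) := by
  rintro x ⟨hx, hx'⟩ y ⟨hy, hy'⟩ u v hu hv huv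
  refine ⟨fun i => ?_, ?_⟩
  · have := mul_nonneg hu (hx i)
    have := mul_nonneg hv (hy i)
    simp only [map_add, map_smul, Finsupp.add_apply, Finsupp.smul_apply, smul_eq_mul]
    positivity
  · simp only [map_add, map_smul, Finsupp.add_apply, Finsupp.smul_apply, smul_eq_mul,
      Finset.sum_add_distrib, ← Finset.mul_sum]
    calc _ ≤ u * t + v * t := by gcongr
      _ = t := by rw [← add_mul, huv, one_mul]

theorem basis_mem_cornerSimplex (b : Module.Basis ι ℝ E) (i : ι) : b i ∈ cornerSimplex b 1 := by
  classical
  refine ⟨fun j => ?_, by simp [Finsupp.single_apply]⟩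
  rw [b.repr_self, Finsupp.single_apply]
  split_ifs <;> norm_num

/-- A convex set containing `0` and the basis vectors contains the unit corner simplex. -/
theorem cornerSimplex_one_subset (b : Module.Basis ι ℝ E) {K : Set E} (hK : Convex ℝ K)
    (h0 : (0 : E) ∈ K) (hb : ∀ i, b i ∈ K) : cornerSimplex b 1 ⊆ K := by
  rintro x ⟨hx, hx1⟩
  have h := hK.sum_mem (t := (Finset.univ : Finset (Option ι)))
    (w := fun o => o.elim (1 - ∑ i, b.repr x i) (fun i => b.repr x i))
    (z := fun o => o.elim 0 b) ?_ ?_ ?_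
  · simpa [Fintype.sum_option, b.sum_repr] using h
  · rintro (_ | i) _
    · simpa using hx1
    · exact hx i
  · simp [Fintype.sum_option]
  · rintro (_ | i) _
    · exact h0
    · exact hb i

variable [MeasurableSpace E] [BorelSpace E]

/-- The part of the simplex of size `k + 1` missed by `S[k + 1]` is controlled by the part of the
simplex of size `k` missed by `S[k]`. A missed point `x` of the larger simplex has all its
translates `x - b i` with `⌊x i⌋ ≥ 1` missed in the smaller one, and the mass at `x` is
distributed among those translates proportionally to `⌊x i⌋`. -/
theorem measure_cornerSimplex_diff_le (μ : Measure E) [μ.IsAddHaarMeasure] {S : Set E}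
    (hS : IsCompact S) (hstar : StarConvex ℝ 0 S) (h0 : (0 : E) ∈ S) (b : Module.Basis ι ℝ E)
    (hb : ∀ i, b i ∈ S) {k : ℕ} (hι : 1 ≤ Fintype.card ι) (hk : Fintype.card ι ≤ k + 1) :
    μ (cornerSimplex b (k + 1) \ minkowskiMultiple S (k + 1))
      ≤ ENNReal.ofReal ((k + 1) / (k + 2 - Fintype.card ι))
        * μ (cornerSimplex b k \ minkowskiMultiple S k) := by
  classical
  set d := Fintype.card ι with hd
  set X := cornerSimplex b (k + 1) \ minkowskiMultiple S (k + 1) with hX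
  set Y := cornerSimplex b k \ minkowskiMultiple S k with hY
  have hXm : MeasurableSet X := (isClosed_cornerSimplex b _).measurableSet.diff
    (hS.minkowskiMultiple _).isClosed.measurableSet
  have hYm : MeasurableSet Y := (isClosed_cornerSimplex b _).measurableSet.diff
    (hS.minkowskiMultiple _).isClosed.measurableSet
  -- Missed points have large integer parts.
  have hceil (x : E) : ∑ i, ⌈b.repr x i⌉₊ ≤ ∑ i, ⌊b.repr x i⌋₊ + d := by
    calc ∑ i, ⌈b.repr x i⌉₊ ≤ ∑ i, (⌊b.repr x i⌋₊ + 1) :=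
          Finset.sum_le_sum fun i _ => Nat.ceil_le_floor_add_one _
      _ = _ := by simp [Finset.sum_add_distrib, hd]
  have hXfloor {x : E} (hx : x ∈ X) : k + 2 ≤ ∑ i, ⌊b.repr x i⌋₊ + d := by
    by_contra! h
    exact hx.2 (mem_minkowskiMultiple_of_sum_ceil_le hstar h0 b hb hx.1.1
      ((hceil x).trans (by omega)))
  have hYfloor {x : E} (hx : x ∈ Y) : k + 1 ≤ ∑ i, ⌊b.repr x i⌋₊ + d := by
    by_contra! h
    exact hx.2 (mem_minkowskiMultiple_of_sum_ceil_le hstar h0 b hb hx.1.1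
      ((hceil x).trans (by omega)))
  let w (i : ι) (y : E) : ENNReal :=
    ENNReal.ofReal (((⌊b.repr y i⌋₊ : ℝ) + 1) / ((∑ j, ⌊b.repr y j⌋₊ : ℕ) + 1))
  have hcoord (i : ι) : Measurable fun y => b.repr y i := (continuous_repr b i).measurable
  have hw (i : ι) : Measurable (Y.indicator (w i)) := by
    refine Measurable.indicator ?_ hYm
    have hfl (j : ι) : Measurable fun y => ⌊b.repr y j⌋₊ := Nat.measurable_floor.comp (hcoord j)
    have hsum : Measurable fun y => (∑ j, ⌊b.repr y j⌋₊ : ℕ) :=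
      Finset.measurable_fun_sum _ fun j _ => hfl j
    exact ENNReal.measurable_ofReal.comp
      (((measurable_from_top.comp (hfl i) : Measurable fun y => (⌊b.repr y i⌋₊ : ℝ)).add_const 1).div
      ((measurable_from_top.comp hsum :
        Measurable fun y => ((∑ j, ⌊b.repr y j⌋₊ : ℕ) : ℝ)).add_const 1))
  have hpoint (x : E) : X.indicator 1 x ≤ ∑ i, Y.indicator (w i) (x - b i) := by
    by_cases hx : x ∈ X
    swap
    · simp [hx]
    rw [Set.indicator_of_mem hx, Pi.one_apply]
    set N := ∑ j, ⌊b.repr x j⌋₊ with hN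
    have hNpos : 0 < N := by have := hXfloor hx; omega
    have hone : (1 : ENNReal) = ∑ i, ENNReal.ofReal ((⌊b.repr x i⌋₊ : ℝ) / N) := by
      rw [← ENNReal.ofReal_sum_of_nonneg fun i _ => by positivity, ← Finset.sum_div,
        ← Nat.cast_sum, ← hN, div_self (Nat.cast_pos.2 hNpos).ne', ENNReal.ofReal_one]
    rw [hone]
    refine Finset.sum_le_sum fun i _ => ?_
    rcases Nat.eq_zero_or_pos ⌊b.repr x i⌋₊ with hi | hi
    · simp [hi]
    have hi1 : 1 ≤ b.repr x i := Nat.floor_pos.1 hi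
    have hrepr (j : ι) : b.repr (x - b i) j = b.repr x j - if j = i then 1 else 0 := by
      simp [Finsupp.single_apply, eq_comm]
    have hfloor (j : ι) : ⌊b.repr x j⌋₊
        = ⌊b.repr (x - b i) j⌋₊ + if j = i then 1 else 0 := by
      rw [hrepr]
      split_ifs with hj
      · rw [hj, Nat.floor_sub_one]; omega
      · simp
    have hxY : x - b i ∈ Y := by
      refine ⟨⟨fun j => ?_, ?_⟩, fun hmem => hx.2 ?_⟩
      · rw [hrepr]
        split_ifs with hj
        · rw [hj]; linarith
        · simpa using hx.1.1 j
      · have := hx.1.2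
        simp only [hrepr, Finset.sum_sub_distrib, Finset.sum_ite_eq', Finset.mem_univ, if_true]
        linarith
      · rw [minkowskiMultiple_succ]
        exact ⟨_, hmem, _, hb i, sub_add_cancel _ _⟩
    have hsum : N = ∑ j, ⌊b.repr (x - b i) j⌋₊ + 1 := by
      rw [hN, Finset.sum_congr rfl fun j _ => hfloor j, Finset.sum_add_distrib]
      simp
    rw [Set.indicator_of_mem hxY]
    have hfi := hfloor i
    rw [if_pos rfl] at hfi
    simp only [w]
    rw [hfi, hsum, Nat.cast_add, Nat.cast_add, Nat.cast_one]
  have hbound (y : E) : ∑ i, Y.indicator (w i) y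
      ≤ Y.indicator (fun _ => ENNReal.ofReal ((k + 1) / (k + 2 - d))) y := by
    by_cases hy : y ∈ Y
    swap
    · simp [hy]
    simp only [Set.indicator_of_mem hy, w]
    rw [← ENNReal.ofReal_sum_of_nonneg fun i _ => by positivity, ← Finset.sum_div,
      Finset.sum_add_distrib, ← Nat.cast_sum]
    simp only [Finset.sum_const, Finset.card_univ, nsmul_eq_mul, mul_one, ← hd]
    refine ENNReal.ofReal_le_ofReal ?_
    have h1 : ((k : ℝ) + 1) ≤ (∑ i, ⌊b.repr y i⌋₊ : ℕ) + d := mod_cast hYfloor hy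
    have h2 : (1 : ℝ) ≤ d := mod_cast hι
    have h3 : (d : ℝ) ≤ k + 1 := mod_cast hk
    rw [div_le_div_iff₀ (by positivity) (by linarith)]
    nlinarith
  calc μ X = ∫⁻ x, X.indicator 1 x ∂μ := (lintegral_indicator_one hXm).symm
    _ ≤ ∫⁻ x, ∑ i, Y.indicator (w i) (x - b i) ∂μ := lintegral_mono hpoint
    _ = ∑ i, ∫⁻ x, Y.indicator (w i) (x - b i) ∂μ :=
        lintegral_finsetSum _ fun i _ => (hw i).comp (measurable_id.sub_const _)
    _ = ∑ i, ∫⁻ x, Y.indicator (w i) x ∂μ :=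
        Finset.sum_congr rfl fun i _ => lintegral_sub_right_eq_self _ _
    _ = ∫⁻ x, ∑ i, Y.indicator (w i) x ∂μ := (lintegral_finsetSum _ fun i _ => hw i).symm
    _ ≤ ∫⁻ x, Y.indicator (fun _ => ENNReal.ofReal ((k + 1) / (k + 2 - d))) x ∂μ :=
        lintegral_mono hbound
    _ = _ := lintegral_indicator_const hYm _

/-- The deficit inequality of `measure_cornerSimplex_diff_le`, rescaled to the unit simplex. -/
theorem measure_cornerSimplex_diff_average_le (μ : Measure E) [μ.IsAddHaarMeasure] {S : Set E}
    (hS : IsCompact S) (hstar : StarConvex ℝ 0 S) (h0 : (0 : E) ∈ S) (b : Module.Basis ι ℝ E)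
    (hb : ∀ i, b i ∈ S) {k : ℕ} (hk0 : 0 < k) (hι : 1 ≤ Fintype.card ι)
    (hk : Fintype.card ι ≤ k + 1) :
    μ (cornerSimplex b 1 \ (1 / ((k : ℝ) + 1)) • minkowskiMultiple S (k + 1))
      ≤ ENNReal.ofReal ((k + 1) / (k + 2 - Fintype.card ι) * (k / (k + 1)) ^ Fintype.card ι)
        * μ (cornerSimplex b 1 \ (1 / (k : ℝ)) • minkowskiMultiple S k) := by
  have : FiniteDimensional ℝ E := b.finiteDimensional_of_finite
  have hk' : (0 : ℝ) < k := Nat.cast_pos.2 hk0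
  have h3 : (Fintype.card ι : ℝ) ≤ k + 1 := mod_cast hk
  have key (t : ℝ) (ht : 0 < t) (M : Set E) : μ (cornerSimplex b t \ M)
      = ENNReal.ofReal (t ^ Fintype.card ι) * μ (cornerSimplex b 1 \ (1 / t) • M) := by
    have hM : M = t • (1 / t) • M := by rw [smul_smul, mul_one_div_cancel ht.ne', one_smul]
    conv_lhs => rw [hM, ← smul_cornerSimplex b ht]
    rw [← Set.smul_set_sdiff₀ ht.ne', Measure.addHaar_smul, Module.finrank_eq_card_basis b,
      abs_of_pos (by positivity)]
  have h := measure_cornerSimplex_diff_le μ hS hstar h0 b hb hι hk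
  rw [key _ (by positivity), key _ hk', ← mul_assoc,
    ← ENNReal.ofReal_mul (by apply div_nonneg <;> linarith)] at h
  have hpos : (0 : ℝ) < (k + 1) ^ Fintype.card ι := by positivity
  have h' := mul_le_mul_right h (ENNReal.ofReal ((k + 1) ^ Fintype.card ι)⁻¹)
  rw [← mul_assoc, ← mul_assoc, ← ENNReal.ofReal_mul (by positivity),
    ← ENNReal.ofReal_mul (by positivity), inv_mul_cancel₀ hpos.ne', ENNReal.ofReal_one,
    one_mul] at h'
  convert h' using 3
  rw [div_pow]
  field_simp

end CornerSimplex

/-! ### Point sets in radially general position -/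

section RadiallyGeneric

variable {E : Type*} [AddCommGroup E] [Module ℝ E]

/-- No point of `F` lies in the affine span of a linearly independent subset `I` of `F`, apart from
the points of `I`. Affine combinations of `I` are recognised among the linear ones by a functional
equal to `1` on `I`. -/
def RadiallyGeneric (F : Set E) : Prop :=
  ∀ I ⊆ F, LinearIndepOn ℝ id I → ∀ q ∈ F, q ∈ Submodule.span ℝ I →
    ∀ y : E →ₗ[ℝ] ℝ, (∀ p ∈ I, y p = 1) → y q = 1 → q ∈ I

theorem radiallyGeneric_empty : RadiallyGeneric (∅ : Set E) := by
  simp [RadiallyGeneric]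

theorem radiallyGeneric_insert {F : Set E} (hF : RadiallyGeneric F) {v : E}
    (hv : ∀ I ⊆ F, LinearIndepOn ℝ id I → v ∈ Submodule.span ℝ I →
      ∀ y : E →ₗ[ℝ] ℝ, (∀ p ∈ I, y p = 1) → y v ≠ 1) :
    RadiallyGeneric (insert v F) := by
  intro I hI hind q hq hqI y hy hyq
  by_contra hqn
  by_cases hvI : v ∈ I
  · obtain ⟨J, hvJ, rfl⟩ : ∃ J, v ∉ J ∧ I = insert v J :=
      ⟨I \ {v}, by simp, by rw [Set.insert_sdiff_singleton, Set.insert_eq_of_mem hvI]⟩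
    have hJF : J ⊆ F := fun p hp =>
      (hI (Set.mem_insert_of_mem _ hp)).resolve_left fun h => hvJ (h ▸ hp)
    have hqF : q ∈ F := hq.resolve_left fun h => hqn (h ▸ Set.mem_insert _ _)
    have hyJ : ∀ p ∈ J, y p = 1 := fun p hp => hy p (Set.mem_insert_of_mem _ hp)
    obtain ⟨hJind, hvspan⟩ := (linearIndepOn_id_insert hvJ).1 hind
    obtain ⟨a, z, hz, rfl⟩ := Submodule.mem_span_insert.1 hqI
    have hqspan : a • v + z ∉ Submodule.span ℝ J := fun h =>
      hqn (Set.mem_insert_of_mem _ (hF J hJF hJind _ hqF h y hyJ hyq))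
    have ha : a ≠ 0 := by
      rintro rfl
      exact hqspan (by simpa using hz)
    -- Exchanging `v` for `q` in `I` puts `v` into the affine span of points of `F`.
    refine hv (insert (a • v + z) J) (Set.insert_subset hqF hJF) (hJind.id_insert hqspan)
      (Submodule.mem_span_insert.2 ⟨a⁻¹, -(a⁻¹ • z),
        neg_mem (Submodule.smul_mem _ _ hz), ?_⟩) y ?_ (hy v (Set.mem_insert _ _))
    · rw [smul_add, smul_smul, inv_mul_cancel₀ ha, one_smul, add_neg_cancel_right]
    · rintro p (rfl | hp)
      exacts [hyq, hyJ p hp]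
  · have hIF : I ⊆ F := fun p hp => (hI hp).resolve_left fun h => hvI (h ▸ hp)
    rcases hq with rfl | hq
    · exact hv I hIF hind hqI y hy hyq
    · exact hqn (hF I hIF hind q hq hqI y hy hyq)

/-- Only finitely many multiples of `p` lie in affine spans of linearly independent subsets of a
finite set, because such an affine span does not contain `0` and so meets the line through `p` at
most once. -/
theorem RadiallyGeneric.exists_insert_smul {F : Set E} (hF : RadiallyGeneric F)
    (hfin : F.Finite) (p : E) {a : ℝ} (ha : a < 1) :
    ∃ s ∈ Set.Ioo a 1, RadiallyGeneric (insert (s • p) F) := by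
  let bad (I : Set E) : Set ℝ := {s | s • p ∈ Submodule.span ℝ I ∧
    ∃ y : E →ₗ[ℝ] ℝ, (∀ q ∈ I, y q = 1) ∧ y (s • p) = 1}
  have hbad (I : Set E) : (bad I).Subsingleton := by
    rintro s ⟨hs, y, hy, hys⟩ t ⟨ht, z, hz, hzt⟩
    have hyz : y (s • p) = z (s • p) :=
      LinearMap.eqOn_span (fun q hq => (hy q hq).trans (hz q hq).symm) hs
    rw [map_smul, smul_eq_mul] at hys hzt hyz
    have hs0 : s ≠ 0 := by rintro rfl; simp at hys
    rw [map_smul, smul_eq_mul] at hyz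
    have : y p = z p := mul_left_cancel₀ hs0 hyz
    rw [← this] at hzt
    have hyp : y p ≠ 0 := by intro h; simp [h] at hys
    exact mul_right_cancel₀ hyp (hys.trans hzt.symm)
  have hfinbad : (⋃ I ∈ 𝒫 F, bad I).Finite :=
    hfin.finite_subsets.biUnion fun I _ => (hbad I).finite
  obtain ⟨s, hs, hsn⟩ := ((Set.Ioo_infinite ha).sdiff hfinbad).nonempty
  refine ⟨s, hs, radiallyGeneric_insert hF fun I hI _ hspan y hy hys => hsn ?_⟩
  exact Set.mem_biUnion (show I ∈ 𝒫 F from hI) ⟨hspan, y, hy, hys⟩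

end RadiallyGeneric

/-! ### Triangulation of a polytope by facets seen from the origin -/

section Triangulation

universe u

variable {E : Type u} [NormedAddCommGroup E] [NormedSpace ℝ E]

/-- The basis `b` consists of points of `F` and spans a supporting hyperplane
`{x | ∑ i, b.repr x i = 1}` of `F` which has `F` and the origin on the same side. -/
def IsFacetBasis {ι : Type*} [Fintype ι] (F : Set E) (b : Module.Basis ι ℝ E) : Prop :=
  (∀ i, b i ∈ F) ∧ ∀ p ∈ F, ∑ i, b.repr p i ≤ 1

theorem sum_repr_eq_apply {ι : Type*} [Fintype ι] (b : Module.Basis ι ℝ E) {y : E →ₗ[ℝ] ℝ}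
    (hy : ∀ i, y (b i) = 1) (x : E) : ∑ i, b.repr x i = y x := by
  conv_rhs => rw [← b.sum_repr x]
  simp only [map_sum, map_smul, smul_eq_mul, hy, mul_one]

/-- The functional summing the coordinates in a basis. -/
noncomputable def sumCoord {ι : Type*} [Fintype ι] (b : Module.Basis ι ℝ E) : E →ₗ[ℝ] ℝ :=
  ∑ i, b.coord i

theorem sumCoord_apply {ι : Type*} [Fintype ι] (b : Module.Basis ι ℝ E) (x : E) :
    sumCoord b x = ∑ i, b.repr x i := by
  simp [sumCoord]

theorem sumCoord_basis {ι : Type*} [Fintype ι] (b : Module.Basis ι ℝ E) (i : ι) :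
    sumCoord b (b i) = 1 := by
  classical
  simp [sumCoord_apply, Finsupp.single_apply]

theorem RadiallyGeneric.mem_range_of_sum_repr_eq_one {ι : Type*} [Fintype ι] {F : Set E}
    (hF : RadiallyGeneric F) {b : Module.Basis ι ℝ E} (hb : ∀ i, b i ∈ F) {q : E} (hq : q ∈ F)
    (h : ∑ i, b.repr q i = 1) : q ∈ Set.range b := by
  refine hF (Set.range b) (Set.range_subset_iff.2 hb) b.linearIndependent.linearIndepOn_id q hq
    (by simp [b.span_eq]) (sumCoord b) ?_ ((sumCoord_apply b q).trans h)
  rintro _ ⟨i, rfl⟩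
  exact sumCoord_basis b i

/-- A point of two facet simplices with positive coordinates in one of them forces every vertex of
the first facet onto the second supporting hyperplane. -/
theorem RadiallyGeneric.range_subset_range {ι : Type*} [Fintype ι] {F : Set E}
    (hF : RadiallyGeneric F) {b c : Module.Basis ι ℝ E} (hb : IsFacetBasis F b)
    (hc : IsFacetBasis F c) {x : E} (hxb : ∀ i, 0 < b.repr x i) (hxc : ∀ i, 0 ≤ c.repr x i) :
    Set.range b ⊆ Set.range c := by
  have expand (u v : Module.Basis ι ℝ E) :
      sumCoord v x = ∑ i, u.repr x i * sumCoord v (u i) := by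
    conv_lhs => rw [← u.sum_repr x]
    simp only [map_sum, map_smul, smul_eq_mul]
  have hle (u v : Module.Basis ι ℝ E) (hu : IsFacetBasis F u) (hv : IsFacetBasis F v) (i : ι) :
      sumCoord v (u i) ≤ 1 := by
    rw [sumCoord_apply]
    exact hv.2 _ (hu.1 i)
  have h1 : sumCoord b x ≤ sumCoord c x := by
    rw [expand c b, sumCoord_apply c]
    exact Finset.sum_le_sum fun i _ => mul_le_of_le_one_right (hxc i) (hle c b hc hb i)
  rw [expand b c, sumCoord_apply b] at h1
  have h2 : ∀ i ∈ Finset.univ, b.repr x i * sumCoord c (b i) ≤ b.repr x i :=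
    fun i _ => mul_le_of_le_one_right (hxb i).le (hle b c hb hc i)
  have h3 := (Finset.sum_eq_sum_iff_of_le h2).1 (le_antisymm (Finset.sum_le_sum h2) h1)
  rintro _ ⟨i, rfl⟩
  refine hF.mem_range_of_sum_repr_eq_one hc.1 (hb.1 i) ?_
  rw [← sumCoord_apply]
  exact (mul_eq_left₀ (hxb i).ne').1 (h3 i (Finset.mem_univ i))

/-- Outside the proper subspaces spanned by subsets of `F`, every point of the polytope with
vertices in `F` and the origin lies in the simplex over a facet: prolong the segment from the
origin to the boundary and take a supporting hyperplane there. -/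
theorem RadiallyGeneric.exists_isFacetBasis [FiniteDimensional ℝ E] [Nontrivial E] {F : Set E} (hF : RadiallyGeneric F)
    (hfin : F.Finite) {x : E} (hx : x ∈ convexHull ℝ (insert 0 F))
    (hgen : ∀ G ⊆ F, x ∈ Submodule.span ℝ G → Submodule.span ℝ G = ⊤) :
    ∃ b : Module.Basis (Fin (Module.finrank ℝ E)) ℝ E, IsFacetBasis F b ∧
      x ∈ cornerSimplex b 1 := by
  set P := convexHull ℝ (insert 0 F) with hP
  have hPc : IsCompact P := (hfin.insert 0).isCompact_convexHull ℝ
  have hconv : Convex ℝ P := convex_convexHull ℝ _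
  have hx0 : x ≠ 0 := by
    rintro rfl
    have := hgen ∅ (Set.empty_subset _) (zero_mem _)
    rw [Submodule.span_empty] at this
    exact bot_ne_top this
  have hPspan : P ⊆ Submodule.span ℝ F :=
    convexHull_min (Set.insert_subset (zero_mem _) Submodule.subset_span)
      (Submodule.span ℝ F).convex
  have hspan : Submodule.span ℝ F = ⊤ := hgen F subset_rfl (hPspan hx)
  have hint : (interior P).Nonempty := by
    rw [interior_convexHull_nonempty_iff_affineSpan_eq_top]
    apply SetLike.coe_injective
    rw [affineSpan_insert_zero, hspan]
    simp
  -- The last point `l • x` of `P` on the ray through `x`.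
  obtain ⟨l, ⟨hl0, hlP⟩, hmax⟩ : ∃ l, IsGreatest {t : ℝ | 0 ≤ t ∧ t • x ∈ P} l := by
    refine IsCompact.exists_isGreatest (Metric.isCompact_of_isClosed_isBounded ?_ ?_)
      ⟨1, zero_le_one, by simpa using hx⟩
    · exact isClosed_Ici.inter (hPc.isClosed.preimage (continuous_id.smul continuous_const))
    · obtain ⟨R, hR⟩ := hPc.isBounded.exists_norm_le
      refine (Metric.isBounded_Icc 0 (R / ‖x‖)).subset fun t ht => ⟨ht.1, ?_⟩
      rw [le_div_iff₀ (norm_pos_iff.2 hx0)]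
      simpa [norm_smul, abs_of_nonneg ht.1] using hR _ ht.2
  have hl1 : 1 ≤ l := hmax ⟨zero_le_one, by simpa using hx⟩
  have hlpos : 0 < l := zero_lt_one.trans_le hl1
  have hxspan (G : Set E) (h : l • x ∈ Submodule.span ℝ G) : x ∈ Submodule.span ℝ G :=
    (Submodule.smul_mem_iff _ hlpos.ne').1 h
  have hlint : l • x ∉ interior P := by
    intro h
    have hcont : ContinuousAt (fun t : ℝ => t • x) l := by fun_prop
    obtain ⟨ε, hε, hball⟩ := Metric.mem_nhds_iff.1
      (hcont.preimage_mem_nhds (isOpen_interior.mem_nhds h))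
    have hmem : (l + ε / 2) • x ∈ interior P := hball (by simp [abs_of_pos hε, hε])
    have := hmax (show l + ε / 2 ∈ {t : ℝ | 0 ≤ t ∧ t • x ∈ P} from
      ⟨by positivity, interior_subset hmem⟩)
    linarith
  obtain ⟨f, hf⟩ := geometric_hahn_banach_open_point hconv.interior isOpen_interior hlint
  have hfP : ∀ p ∈ P, f p ≤ f (l • x) := by
    intro p hp
    have hcl : p ∈ closure (interior P) := by
      rw [hconv.closure_interior_eq_closure_of_nonempty_interior hint]
      exact subset_closure hp
    exact closure_minimal (fun q hq => (hf q hq).le)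
      (isClosed_le f.continuous continuous_const) hcl
  -- Only points on the supporting hyperplane carry weight in a convex combination for `l • x`.
  obtain ⟨w, hw0, hw1, hwz⟩ : ∃ w : E → ℝ, (∀ p ∈ (hfin.insert 0).toFinset, 0 ≤ w p) ∧
      ∑ p ∈ (hfin.insert 0).toFinset, w p = 1 ∧
      ∑ p ∈ (hfin.insert 0).toFinset, w p • p = l • x := by
    rw [← Finset.mem_convexHull', Set.Finite.coe_toFinset]
    exact hlP
  set s := (hfin.insert 0).toFinset with hs
  have hsP : ∀ p ∈ s, p ∈ P := fun p hp =>
    subset_convexHull ℝ _ ((hfin.insert 0).mem_toFinset.1 hp)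
  have hws : ∀ p ∈ s, w p = 0 ∨ f p = f (l • x) := by
    have hsum : ∑ p ∈ s, w p * f p = ∑ p ∈ s, w p * f (l • x) := by
      rw [← Finset.sum_mul, hw1, one_mul]
      conv_rhs => rw [← hwz]
      simp
    intro p hp
    have := (Finset.sum_eq_sum_iff_of_le fun p hp =>
      mul_le_mul_of_nonneg_left (hfP p (hsP p hp)) (hw0 p hp)).1 hsum p hp
    exact (mul_eq_mul_left_iff.1 this).symm
  have hzspan : l • x ∈ Submodule.span ℝ {p ∈ F | f p = f (l • x)} := by
    rw [← hwz]
    refine Submodule.sum_mem _ fun p hp => ?_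
    rcases hws p hp with h | h
    · simp [h]
    · rcases (hfin.insert 0).mem_toFinset.1 hp with rfl | hpF
      · simp
      · exact Submodule.smul_mem _ _ (Submodule.subset_span ⟨hpF, by rwa [hwz]⟩)
  have hGspan := hgen _ (Set.sep_subset _ _) (hxspan _ hzspan)
  have hfz : 0 < f (l • x) := by
    refine lt_of_le_of_ne ?_ fun h => ?_
    · simpa using hfP 0 (subset_convexHull ℝ _ (Set.mem_insert _ _))
    · -- Otherwise `f` vanishes on a spanning set.
      have hker : Submodule.span ℝ {p ∈ F | f p = f (l • x)} ≤ LinearMap.ker f.toLinearMap :=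
        Submodule.span_le.2 fun p hp => by simpa [← h] using hp.2
      rw [hGspan, top_le_iff] at hker
      obtain ⟨q, hq⟩ := hint
      have hq' : q ∈ LinearMap.ker f.toLinearMap := hker ▸ Submodule.mem_top
      have hq0 : f q = 0 := by simpa using hq'
      have := hf q hq
      rw [hq0, ← h] at this
      exact lt_irrefl _ this
  obtain ⟨I, hIG, hIspan, hIind⟩ := exists_linearIndependent ℝ {p ∈ F | f p = f (l • x)}
  let b₀ : Module.Basis I ℝ E := Module.Basis.mk hIind (by
    rw [Subtype.range_coe, hIspan, hGspan])
  have : Finite I := Module.Finite.finite_basis b₀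
  let e : I ≃ Fin (Module.finrank ℝ E) :=
    Finite.equivFinOfCardEq (Module.finrank_eq_nat_card_basis b₀).symm
  let b := b₀.reindex e
  have hbG (i) : b i ∈ {p ∈ F | f p = f (l • x)} := by
    have : b i = (e.symm i : E) := by simp [b, b₀]
    rw [this]
    exact hIG (e.symm i).2
  have hsumf (p : E) : ∑ i, b.repr p i = f p / f (l • x) := by
    rw [sum_repr_eq_apply b (y := (f (l • x))⁻¹ • f.toLinearMap)]
    · simp [div_eq_inv_mul]
    · intro i
      simp only [LinearMap.smul_apply, smul_eq_mul]
      exact (congrArg _ (hbG i).2).trans (inv_mul_cancel₀ hfz.ne')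
  have hbF (i) : b i ∈ F := (hbG i).1
  refine ⟨b, ⟨hbF, fun p hp => ?_⟩, fun i => ?_, ?_⟩
  · rw [hsumf]
    exact div_le_one_of_le₀ (hfP p (subset_convexHull ℝ _ (Set.mem_insert_of_mem _ hp))) hfz.le
  · have hrepr : 0 ≤ b.repr (l • x) i := by
      rw [← hwz]
      simp only [map_sum, map_smul, Finsupp.coe_finsetSum, Finset.sum_apply, Finsupp.smul_apply,
        smul_eq_mul]
      refine Finset.sum_nonneg fun p hp => ?_
      rcases hws p hp with h | h
      · simp [h]
      rcases (hfin.insert 0).mem_toFinset.1 hp with rfl | hpF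
      · simp
      · obtain ⟨j, rfl⟩ := hF.mem_range_of_sum_repr_eq_one hbF hpF (by
          rw [hsumf, h, div_self hfz.ne'])
        exact mul_nonneg (hw0 _ hp) ((basis_mem_cornerSimplex b j).1 i)
    rw [map_smul, Finsupp.smul_apply, smul_eq_mul] at hrepr
    exact nonneg_of_mul_nonneg_right hrepr hlpos
  · rw [hsumf, map_smul, smul_eq_mul]
    rw [map_smul, smul_eq_mul] at hfz
    rw [div_le_one hfz]
    exact le_mul_of_one_le_left (pos_of_mul_pos_right hfz hlpos.le).le hl1

variable [FiniteDimensional ℝ E] [MeasurableSpace E] [BorelSpace E]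

/-- Up to null sets, the simplices over the facet bases tile the polytope. -/
theorem RadiallyGeneric.exists_triangulation [Nontrivial E] (μ : Measure E) [μ.IsAddHaarMeasure]
    {F : Set E} (hF : RadiallyGeneric F) (hfin : F.Finite) :
    ∃ (κ : Type u) (_ : Fintype κ) (b : κ → Module.Basis (Fin (Module.finrank ℝ E)) ℝ E),
      (∀ j i, b j i ∈ F) ∧
      Pairwise (Function.onFun (AEDisjoint μ) fun j => cornerSimplex (b j) 1) ∧
      μ (convexHull ℝ (insert 0 F) \ ⋃ j, cornerSimplex (b j) 1) = 0 := by
  classical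
  let κ := {I : Set E // I ⊆ F ∧
    ∃ b : Module.Basis (Fin (Module.finrank ℝ E)) ℝ E, IsFacetBasis F b ∧ Set.range b = I}
  have hκ : Finite κ := (hfin.finite_subsets.subset fun I hI => hI.1).to_subtype
  choose b hb hbI using fun j : κ => j.2.2
  refine ⟨κ, Fintype.ofFinite κ, b, fun j => (hb j).1, fun j j' hjj' => ?_, ?_⟩
  · have hsub : cornerSimplex (b j) 1 ∩ cornerSimplex (b j') 1
        ⊆ ⋃ i, (LinearMap.ker ((b j).coord i) ∪ LinearMap.ker ((b j').coord i) : Set E) := by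
      rintro x ⟨hx, hx'⟩
      by_contra hcon
      simp only [Set.mem_iUnion, Set.mem_union, SetLike.mem_coe, LinearMap.mem_ker,
        Module.Basis.coord_apply, not_exists, not_or] at hcon
      refine hjj' (Subtype.ext ?_)
      rw [← hbI j, ← hbI j']
      exact (hF.range_subset_range (hb j) (hb j')
        (fun i => (hx.1 i).lt_of_ne' (hcon i).1) hx'.1).antisymm
        (hF.range_subset_range (hb j') (hb j)
        (fun i => (hx'.1 i).lt_of_ne' (hcon i).2) hx.1)
    have hker (c : Module.Basis (Fin (Module.finrank ℝ E)) ℝ E) (i) :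
        μ (LinearMap.ker (c.coord i) : Set E) = 0 := by
      refine Measure.addHaar_submodule μ _ fun h => ?_
      have hmem : c i ∈ LinearMap.ker (c.coord i) := h ▸ Submodule.mem_top
      simp at hmem
    exact measure_mono_null hsub (measure_iUnion_null fun i =>
      measure_union_null (hker _ _) (hker _ _))
  · refine measure_mono_null (t := ⋃ G ∈ {G ∈ 𝒫 F | Submodule.span ℝ G ≠ ⊤},
      (Submodule.span ℝ G : Set E)) ?_ ?_
    · rintro x ⟨hx, hxn⟩
      by_contra hcon
      simp only [Set.mem_iUnion, not_exists] at hcon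
      obtain ⟨c, hc, hxc⟩ := hF.exists_isFacetBasis hfin hx fun G hG hxG => by
        by_contra hne
        exact hcon G ⟨hG, hne⟩ hxG
      let j : κ := ⟨Set.range c, Set.range_subset_iff.2 hc.1, c, hc, rfl⟩
      refine hxn (Set.mem_iUnion.2 ⟨j, ?_⟩)
      -- The chosen basis of the same facet gives the same simplex.
      have hmem : ∀ i, c i ∈ Set.range (b j) := fun i => by rw [hbI j]; exact ⟨i, rfl⟩
      refine (cornerSimplex_one_subset c ?_ (cornerSimplex_zero_mem _ zero_le_one) ?_) hxc
      · exact convex_cornerSimplex _ _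
      · intro i
        obtain ⟨i', hi'⟩ := hmem i
        rw [← hi']
        exact basis_mem_cornerSimplex _ _
    · exact (measure_biUnion_null_iff (hfin.finite_subsets.subset fun G hG => hG.1).countable).2
        fun G hG => Measure.addHaar_submodule μ _ hG.2

end Triangulation

/-! ### The deficit inequality -/

section Deficit

variable {E : Type*} [NormedAddCommGroup E] [NormedSpace ℝ E] [FiniteDimensional ℝ E]

/-- Moving the points of a dense sequence slightly towards the origin exhausts a star-shaped set
by finite sets in radially general position. -/
theorem StarConvex.exists_monotone_radiallyGeneric {S : Set E} (hstar : StarConvex ℝ 0 S)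
    (h0 : (0 : E) ∈ S) :
    ∃ F : ℕ → Set E, Monotone F ∧
      (∀ n, (F n).Finite ∧ F n ⊆ S ∧ RadiallyGeneric (F n)) ∧ S ⊆ closure (⋃ n, F n) := by
  have : Nonempty S := ⟨⟨0, h0⟩⟩
  -- Unpairing repeats every point infinitely often, with factors tending to `1`.
  let p (n : ℕ) : E := TopologicalSpace.denseSeq S n.unpair.1
  have hpS (n) : p n ∈ S := (TopologicalSpace.denseSeq S _).2
  let α := {F : Set E // F.Finite ∧ F ⊆ S ∧ RadiallyGeneric F}
  have step (n : ℕ) (F : α) : ∃ G : α, F.1 ⊆ G.1 ∧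
      ∃ s ∈ Set.Ioo (1 - 1 / ((n : ℝ) + 1)) 1, s • p n ∈ G.1 := by
    obtain ⟨s, hs, hgen⟩ := F.2.2.2.exists_insert_smul F.2.1 (p n)
      (sub_lt_self (1 : ℝ) (show (0 : ℝ) < 1 / ((n : ℝ) + 1) by positivity))
    have hs0 : 0 ≤ s := by
      have : 1 / ((n : ℝ) + 1) ≤ 1 := by
        rw [div_le_one (by positivity)]
        linarith [(Nat.cast_nonneg n : (0 : ℝ) ≤ n)]
      linarith [hs.1]
    exact ⟨⟨insert (s • p n) F.1, F.2.1.insert _,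
      Set.insert_subset (hstar.smul_mem (hpS n) hs0 hs.2.le) F.2.2.1, hgen⟩,
      Set.subset_insert _ _, s, hs, Set.mem_insert _ _⟩
  choose G hFG s hs hsG using step
  let F : ℕ → α := Nat.rec ⟨∅, Set.finite_empty, Set.empty_subset _, radiallyGeneric_empty⟩ G
  have hF (n) : F (n + 1) = G n (F n) := rfl
  refine ⟨fun n => (F n).1, monotone_nat_of_le_succ fun n => hFG n (F n), fun n => (F n).2, ?_⟩
  intro x hx
  rw [Metric.mem_closure_iff]
  intro ε hε
  obtain ⟨_, ⟨i, rfl⟩, hi⟩ := Metric.mem_closure_iff.1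
    ((TopologicalSpace.denseRange_denseSeq S) ⟨x, hx⟩) (ε / 2) (half_pos hε)
  obtain ⟨q, hq⟩ : ∃ q : E, q = TopologicalSpace.denseSeq S i := ⟨_, rfl⟩
  rw [Subtype.dist_eq, ← hq] at hi
  obtain ⟨j, hj⟩ := exists_nat_gt (‖q‖ / (ε / 2))
  set n := Nat.pair i j with hn
  have hpn : p n = q := by simp [p, hn, hq]
  refine ⟨s n (F n) • p n, Set.mem_iUnion.2 ⟨n + 1, by rw [hF]; exact hsG n (F n)⟩, ?_⟩
  have hjn : (j : ℝ) ≤ n := mod_cast Nat.right_le_pair i j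
  have hdist : dist q (s n (F n) • p n) < ε / 2 := by
    obtain ⟨h1, h2⟩ := hs n (F n)
    have hn0 : (0 : ℝ) < (n : ℝ) + 1 := by positivity
    rw [hpn, dist_eq_norm]
    have hsub : q - s n (F n) • q = (1 - s n (F n)) • q := by rw [sub_smul, one_smul]
    rw [hsub, norm_smul, Real.norm_of_nonneg (by linarith)]
    rw [div_lt_iff₀ (half_pos hε)] at hj
    calc (1 - s n (F n)) * ‖q‖ ≤ 1 / ((n : ℝ) + 1) * ‖q‖ := by
          gcongr
          linarith
      _ < ε / 2 := by
          rw [one_div_mul_eq_div, div_lt_iff₀ hn0]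
          nlinarith
  calc dist x _ ≤ dist x q + dist q _ := dist_triangle _ _ _
    _ < ε / 2 + ε / 2 := add_lt_add hi hdist
    _ = ε := add_halves ε

variable [MeasurableSpace E] [BorelSpace E]

theorem measure_polytope_diff_average_le [Nontrivial E] (μ : Measure E) [μ.IsAddHaarMeasure]
    {S : Set E} (hS : IsCompact S) (hstar : StarConvex ℝ 0 S) (h0 : (0 : E) ∈ S) {k : ℕ}
    (hk0 : 0 < k) (hk : Module.finrank ℝ E ≤ k + 1) {F : Set E} (hF : RadiallyGeneric F)
    (hfin : F.Finite) (hFS : F ⊆ S) :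
    μ (convexHull ℝ (insert 0 F) \ (1 / ((k : ℝ) + 1)) • minkowskiMultiple S (k + 1))
      ≤ ENNReal.ofReal ((k + 1) / (k + 2 - Module.finrank ℝ E)
          * (k / (k + 1)) ^ Module.finrank ℝ E)
        * μ (convexHull ℝ (insert 0 F) \ (1 / (k : ℝ)) • minkowskiMultiple S k) := by
  obtain ⟨κ, _, b, hbF, hdisj, hcover⟩ := hF.exists_triangulation μ hfin
  have hsub (j) : cornerSimplex (b j) 1 ⊆ convexHull ℝ (insert 0 F) :=
    cornerSimplex_one_subset _ (convex_convexHull ℝ _)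
      (subset_convexHull ℝ _ (Set.mem_insert _ _))
      fun i => subset_convexHull ℝ _ (Set.mem_insert_of_mem _ (hbF j i))
  set A := (1 / (k : ℝ)) • minkowskiMultiple S k with hA
  set B := (1 / ((k : ℝ) + 1)) • minkowskiMultiple S (k + 1) with hB
  set P := convexHull ℝ (insert 0 F)
  set r := ENNReal.ofReal ((k + 1) / (k + 2 - Module.finrank ℝ E)
    * (k / (k + 1)) ^ Module.finrank ℝ E) with hr
  have hAm : MeasurableSet A := ((hS.minkowskiMultiple k).smul _).isClosed.measurableSet
  have hsimplex (j) : μ (cornerSimplex (b j) 1 \ B) ≤ r * μ (cornerSimplex (b j) 1 \ A) := by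
    have := measure_cornerSimplex_diff_average_le μ hS hstar h0 (b j)
      (fun i => hFS (hbF j i)) hk0
      (by rw [Fintype.card_fin]; exact Module.finrank_pos) (by rwa [Fintype.card_fin])
    simpa only [Fintype.card_fin] using this
  calc μ (P \ B)
      ≤ μ ((P \ ⋃ j, cornerSimplex (b j) 1) ∪ ⋃ j, (cornerSimplex (b j) 1 \ B)) := by
        refine measure_mono fun x hx => ?_
        by_cases h : x ∈ ⋃ j, cornerSimplex (b j) 1
        · obtain ⟨j, hj⟩ := Set.mem_iUnion.1 h
          exact Or.inr (Set.mem_iUnion.2 ⟨j, hj, hx.2⟩)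
        · exact Or.inl ⟨hx.1, h⟩
    _ ≤ 0 + ∑ j, μ (cornerSimplex (b j) 1 \ B) := by
        refine (measure_union_le _ _).trans (add_le_add hcover.le ?_)
        exact measure_iUnion_fintype_le μ _
    _ ≤ ∑ j, r * μ (cornerSimplex (b j) 1 \ A) := by
        rw [zero_add]
        exact Finset.sum_le_sum fun j _ => hsimplex j
    _ = r * μ (⋃ j, (cornerSimplex (b j) 1 \ A)) := by
        rw [measure_iUnion₀ (fun i j hij => (hdisj hij).mono Set.sdiff_subset Set.sdiff_subset)
          fun j => ((isClosed_cornerSimplex _ _).measurableSet.diff hAm).nullMeasurableSet,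
          tsum_fintype, Finset.mul_sum]
    _ ≤ r * μ (P \ A) := by
        gcongr
        exact Set.iUnion_subset fun j => Set.sdiff_subset_sdiff_left (hsub j)

theorem measure_convexHull_diff_average_le [Nontrivial E] (μ : Measure E) [μ.IsAddHaarMeasure]
    {S : Set E} (hS : IsCompact S) (hstar : StarConvex ℝ 0 S) (h0 : (0 : E) ∈ S) {k : ℕ}
    (hk0 : 0 < k) (hk : Module.finrank ℝ E ≤ k + 1) :
    μ (convexHull ℝ S \ (1 / ((k : ℝ) + 1)) • minkowskiMultiple S (k + 1))
      ≤ ENNReal.ofReal ((k + 1) / (k + 2 - Module.finrank ℝ E)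
          * (k / (k + 1)) ^ Module.finrank ℝ E)
        * μ (convexHull ℝ S \ (1 / (k : ℝ)) • minkowskiMultiple S k) := by
  set A := (1 / (k : ℝ)) • minkowskiMultiple S k
  set B := (1 / ((k : ℝ) + 1)) • minkowskiMultiple S (k + 1)
  set K := convexHull ℝ S with hK
  have hKconv : Convex ℝ K := convex_convexHull ℝ S
  have hfront : μ (frontier K) = 0 := hKconv.addHaar_frontier μ
  obtain ⟨F, hmono, hF, hdense⟩ := hstar.exists_monotone_radiallyGeneric h0
  have hPmono : Monotone fun n => convexHull ℝ (insert 0 (F n)) :=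
    fun m n hmn => convexHull_mono (Set.insert_subset_insert (hmono hmn))
  set U := ⋃ n, convexHull ℝ (insert 0 (F n)) with hU
  have hUconv : Convex ℝ U :=
    hPmono.directed_le.convex_iUnion fun n => convex_convexHull ℝ _
  have hUK : U ⊆ K := Set.iUnion_subset fun n =>
    convexHull_mono (Set.insert_subset h0 (hF n).2.1)
  have hKU : K ⊆ closure U := by
    refine convexHull_min (hdense.trans (closure_mono ?_)) hUconv.closure
    exact Set.iUnion_mono fun n => (Set.subset_insert _ _).trans (subset_convexHull ℝ _)
  have hintKU : interior K ⊆ U := by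
    rcases (interior K).eq_empty_or_nonempty with h | h
    · simp [h]
    have hspan : affineSpan ℝ U = ⊤ := by
      rw [hKconv.interior_nonempty_iff_affineSpan_eq_top, eq_top_iff] at h
      refine eq_top_iff.2 (h.trans (affineSpan_le.2 (hKU.trans ?_)))
      exact closure_minimal (subset_affineSpan ℝ U)
        (AffineSubspace.closed_of_finiteDimensional _)
    rw [← hUconv.interior_nonempty_iff_affineSpan_eq_top] at hspan
    refine (interior_mono hKU).trans ?_
    rw [hUconv.interior_closure_eq_interior_of_nonempty_interior hspan]
    exact interior_subset
  calc μ (K \ B) ≤ μ ((U \ B) ∪ frontier K) := by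
        refine measure_mono fun x hx => ?_
        by_cases h : x ∈ interior K
        · exact Or.inl ⟨hintKU h, hx.2⟩
        · exact Or.inr ⟨subset_closure hx.1, h⟩
    _ ≤ μ (U \ B) := by
        refine (measure_union_le _ _).trans ?_
        rw [hfront, add_zero]
    _ = ⨆ n, μ (convexHull ℝ (insert 0 (F n)) \ B) := by
        rw [hU, Set.iUnion_sdiff]
        exact Monotone.measure_iUnion fun m n hmn => Set.sdiff_subset_sdiff_left (hPmono hmn)
    _ ≤ _ := by
        refine iSup_le fun n => ?_
        refine (measure_polytope_diff_average_le μ hS hstar h0 hk0 hk (hF n).2.2 (hF n).1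
          (hF n).2.1).trans ?_
        gcongr
        exact (Set.subset_iUnion (fun n => convexHull ℝ (insert 0 (F n))) n).trans hUK

end Deficit

/-! ### The contraction factor -/

theorem pow_succ_mul_le_add_one_pow (n : ℕ) {k : ℝ} (hk : 0 ≤ k) :
    k ^ n * (k + n + 1) ≤ (k + 1) ^ (n + 1) := by
  induction n with
  | zero => simp
  | succ n ih =>
    have h : 0 ≤ k ^ n := pow_nonneg hk n
    calc k ^ (n + 1) * (k + (n + 1 : ℕ) + 1) = k ^ n * (k * (k + n + 2)) := by push_cast; ring
      _ ≤ k ^ n * ((k + n + 1) * (k + 1)) := by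
          refine mul_le_mul_of_nonneg_left ?_ h
          nlinarith [(Nat.cast_nonneg n : (0 : ℝ) ≤ n)]
      _ = k ^ n * (k + n + 1) * (k + 1) := by ring
      _ ≤ (k + 1) ^ (n + 1) * (k + 1) := by gcongr
      _ = _ := by ring

theorem pow_succ_mul_lt_add_one_pow {n : ℕ} (hn : n ≠ 0) {k : ℝ} (hk : 0 < k) :
    k ^ n * (k + n + 1) < (k + 1) ^ (n + 1) := by
  obtain ⟨n, rfl⟩ := Nat.exists_eq_add_one_of_ne_zero hn
  have h : 0 < k ^ n := pow_pos hk n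
  calc k ^ (n + 1) * (k + (n + 1 : ℕ) + 1) = k ^ n * (k * (k + n + 2)) := by push_cast; ring
    _ < k ^ n * ((k + n + 1) * (k + 1)) := by
        refine mul_lt_mul_of_pos_left ?_ h
        nlinarith [(Nat.cast_nonneg n : (0 : ℝ) ≤ n)]
    _ = k ^ n * (k + n + 1) * (k + 1) := by ring
    _ ≤ (k + 1) ^ (n + 1) * (k + 1) := by gcongr; exact pow_succ_mul_le_add_one_pow n hk.le
    _ = _ := by ring

theorem dim_le_add_one {d k : ℕ} (hd : 2 ≤ d) (hk : max 2 ((d - 1) * (d - 2)) ≤ k) :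
    d ≤ k + 1 := by
  obtain ⟨n, rfl⟩ := Nat.exists_eq_add_of_le' hd
  obtain ⟨h2, h⟩ := max_le_iff.1 hk
  simp only [Nat.add_sub_cancel, Nat.add_succ_sub_one] at h
  rcases Nat.lt_or_ge n 2 with hn | hn
  · omega
  · nlinarith

/-- The numerical condition on `k` enters here: `k ≥ (d - 1) (d - 2)` is equivalent to
`(k - (d - 2)) (k + d - 1) ≥ k ^ 2`, and `k ^ (d - 2) (k + d - 1)` is at most `(k + 1) ^ (d - 1)` by
Bernoulli's inequality. -/
theorem contraction_factor_lt_one {d k : ℕ} (hd : 2 ≤ d) (hk : max 2 ((d - 1) * (d - 2)) ≤ k) :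
    ((k : ℝ) + 1) / (k + 2 - d) * (k / (k + 1)) ^ d < 1 := by
  have hdk := dim_le_add_one hd hk
  obtain ⟨n, rfl⟩ := Nat.exists_eq_add_of_le' hd
  obtain ⟨h2, h⟩ := max_le_iff.1 hk
  simp only [Nat.add_sub_cancel, Nat.add_succ_sub_one] at h
  have hk' : (0 : ℝ) < k := by exact_mod_cast (by omega : 0 < k)
  have h' : ((n : ℝ) + 1) * n ≤ k := mod_cast h
  have hnk : (0 : ℝ) < k - n := by
    have : (n : ℝ) + 1 ≤ k := by exact_mod_cast (by omega : n + 1 ≤ k)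
    linarith
  have key : (k : ℝ) ^ (n + 2) < (k - n) * (k + 1) ^ (n + 1) := by
    rcases Nat.eq_zero_or_pos n with rfl | hn
    · rw [Nat.cast_zero, sub_zero, zero_add, pow_one, pow_two]
      exact mul_lt_mul_of_pos_left (lt_add_one _) hk'
    · calc (k : ℝ) ^ (n + 2) = k ^ n * (k * k) := by ring
        _ ≤ k ^ n * ((k - n) * (k + n + 1)) := by
            refine mul_le_mul_of_nonneg_left ?_ (pow_nonneg hk'.le n)
            nlinarith
        _ = (k - n) * (k ^ n * (k + n + 1)) := by ring
        _ < _ := by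
            gcongr
            exact pow_succ_mul_lt_add_one_pow hn.ne' hk'
  have hden : (k : ℝ) + 2 - (n + 2 : ℕ) = k - n := by push_cast; ring
  rw [hden, div_pow, div_mul_div_comm, div_lt_one (by positivity)]
  calc ((k : ℝ) + 1) * k ^ (n + 2) < (k + 1) * ((k - n) * (k + 1) ^ (n + 1)) := by gcongr
    _ = _ := by ring

/-! ### Monotonicity of the volume -/

section Monotonicity

variable {E : Type*} [NormedAddCommGroup E] [NormedSpace ℝ E]

theorem measure_average_add_deficit [MeasurableSpace E] [BorelSpace E] (μ : Measure E)
    {S : Set E}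
    (hS : IsCompact S) {k : ℕ} (hk : k ≠ 0) :
    μ ((1 / (k : ℝ)) • minkowskiMultiple S k)
      + μ (convexHull ℝ S \ (1 / (k : ℝ)) • minkowskiMultiple S k) = μ (convexHull ℝ S) := by
  rw [← measure_inter_add_sdiff (convexHull ℝ S)
    ((hS.minkowskiMultiple k).smul (1 / (k : ℝ))).isClosed.measurableSet,
    Set.inter_eq_right.2 (average_subset_convexHull hk)]

variable [FiniteDimensional ℝ E]

theorem affineDim_lt_iff_interior_eq_empty {S : Set E} (hne : S.Nonempty) :
    affineDim S < Module.finrank ℝ E ↔ interior (convexHull ℝ S) = ∅ := by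
  rw [← not_iff_not, ← ne_eq (interior _), ← Set.nonempty_iff_ne_empty,
    interior_convexHull_nonempty_iff_affineSpan_eq_top,
    ← AffineSubspace.direction_eq_top_iff_of_nonempty ((affineSpan_nonempty ℝ).2 hne)]
  constructor
  · intro h
    by_contra hne
    exact h (Submodule.finrank_lt hne)
  · intro h
    rw [affineDim, h, finrank_top]
    exact lt_irrefl _

variable [MeasurableSpace E] [BorelSpace E]

/-- The deficit inequality with the centre of the star translated to the origin. -/
theorem IsStarShaped.exists_deficit_contraction (μ : Measure E) [μ.IsAddHaarMeasure]
    {S : Set E} (hS : IsCompact S) (hstar : IsStarShaped S) {k : ℕ}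
    (hd : 2 ≤ Module.finrank ℝ E)
    (hk : max 2 ((Module.finrank ℝ E - 1) * (Module.finrank ℝ E - 2)) ≤ k) :
    ∃ c : ENNReal, c < 1 ∧
      μ (convexHull ℝ S \ (1 / ((k : ℝ) + 1)) • minkowskiMultiple S (k + 1))
        ≤ c * μ (convexHull ℝ S \ (1 / (k : ℝ)) • minkowskiMultiple S k) := by
  obtain ⟨⟨q, hq⟩, p, hp⟩ := hstar
  have hpS : p ∈ S := hp.mem ⟨q, hq⟩
  have : Nontrivial E := Module.nontrivial_of_finrank_pos (R := ℝ) (by omega)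
  have hk0 : 0 < k := by have := (max_le_iff.1 hk).1; omega
  obtain ⟨T, rfl⟩ : ∃ T : Set E, S = p +ᵥ T := ⟨-p +ᵥ S, by rw [vadd_vadd]; simp⟩
  have hT : IsCompact T := by
    have := hS.vadd (-p)
    rwa [vadd_vadd, neg_add_cancel, zero_vadd] at this
  have h0 : (0 : E) ∈ T := by
    obtain ⟨x, hx, hxp⟩ := hpS
    have : x = 0 := by simpa using hxp
    rwa [← this]
  have hTstar : StarConvex ℝ 0 T := by
    intro x hx u v hu hv huv
    obtain ⟨y, hy, hyx⟩ := hp ⟨x, hx, rfl⟩ hu hv huv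
    have : y = u • (0 : E) + v • x := by
      apply add_left_cancel (a := p)
      calc p + y = u • p + v • (p + x) := hyx
        _ = (u + v) • p + v • x := by module
        _ = p + (u • (0 : E) + v • x) := by rw [huv, one_smul, smul_zero, zero_add]
    rwa [← this]
  refine ⟨_, ENNReal.ofReal_lt_one.2 (contraction_factor_lt_one hd hk), ?_⟩
  have hmain := measure_convexHull_diff_average_le μ hT hTstar h0 hk0 (dim_le_add_one hd hk)
  have hk1 := average_vadd (A := T) p (Nat.succ_ne_zero k)
  rw [Nat.succ_eq_add_one, Nat.cast_add, Nat.cast_one] at hk1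
  rw [convexHull_vadd, hk1, average_vadd p hk0.ne', ← Set.vadd_set_sdiff, ← Set.vadd_set_sdiff,
    measure_vadd, measure_vadd]
  exact hmain

theorem IsStarShaped.measure_average_le_and_eq_iff (μ : Measure E) [μ.IsAddHaarMeasure]
    {S : Set E} (hS : IsCompact S) (hstar : IsStarShaped S) {k : ℕ}
    (hd : 2 ≤ Module.finrank ℝ E)
    (hk : max 2 ((Module.finrank ℝ E - 1) * (Module.finrank ℝ E - 2)) ≤ k) :
    μ ((1 / (k : ℝ)) • minkowskiMultiple S k)
        ≤ μ ((1 / ((k : ℝ) + 1)) • minkowskiMultiple S (k + 1)) ∧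
      (μ ((1 / ((k : ℝ) + 1)) • minkowskiMultiple S (k + 1))
          = μ ((1 / (k : ℝ)) • minkowskiMultiple S k) ↔
        affineDim S < Module.finrank ℝ E ∨
          (1 / (k : ℝ)) • minkowskiMultiple S k = convexHull ℝ S) := by
  have hk0 : k ≠ 0 := by have := (max_le_iff.1 hk).1; omega
  obtain ⟨c, hc, hdef⟩ := hstar.exists_deficit_contraction μ hS hd hk
  have hA := measure_average_add_deficit μ hS hk0
  have hB := measure_average_add_deficit μ hS k.succ_ne_zero
  have hAK := average_subset_convexHull (A := S) hk0
  have hAclosed : IsClosed ((1 / (k : ℝ)) • minkowskiMultiple S k) :=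
    ((hS.minkowskiMultiple k).smul _).isClosed
  rw [Nat.succ_eq_add_one, Nat.cast_add, Nat.cast_one] at hB
  have hKfin : μ (convexHull ℝ S) ≠ ⊤ :=
    (isBounded_convexHull.2 hS.isBounded).measure_lt_top.ne
  rw [affineDim_lt_iff_interior_eq_empty hstar.1]
  set A := (1 / (k : ℝ)) • minkowskiMultiple S k
  set B := (1 / ((k : ℝ) + 1)) • minkowskiMultiple S (k + 1)
  set K := convexHull ℝ S with hK
  have hDfin : μ (K \ A) ≠ ⊤ := measure_ne_top_of_subset Set.sdiff_subset hKfin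
  have hAfin : μ A ≠ ⊤ := measure_ne_top_of_subset hAK hKfin
  have hDle : μ (K \ B) ≤ μ (K \ A) :=
    hdef.trans ((mul_le_mul_left hc.le _).trans_eq (one_mul _))
  have hle : μ A ≤ μ B := by
    refine ENNReal.le_of_add_le_add_right hDfin ?_
    rw [hA, ← hB]
    exact add_le_add_right hDle _
  have hBK : μ B ≤ μ K := by rw [← hB]; exact le_self_add
  refine ⟨hle, fun h => ?_, ?_⟩
  · have hD : μ (K \ B) = μ (K \ A) := by
      rw [h, ← hA] at hB
      exact (ENNReal.add_right_inj hAfin).1 hB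
    have hD0 : μ (K \ A) = 0 := by
      by_contra hne
      rw [hD] at hdef
      refine hdef.not_gt ?_
      conv_rhs => rw [← one_mul (μ (K \ A))]
      exact (ENNReal.mul_lt_mul_iff_left hne hDfin).2 hc
    rcases (interior K).eq_empty_or_nonempty with hint | hint
    · exact Or.inl hint
    · refine Or.inr (hAK.antisymm ?_)
      -- An open null set is empty, so `A` contains the interior of `K`, hence its closure.
      have hopen : interior K \ A = ∅ :=
        ((isOpen_interior.sdiff hAclosed).measure_eq_zero_iff μ).1
          (measure_mono_null (Set.sdiff_subset_sdiff_left interior_subset) hD0)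
      have hconv : Convex ℝ K := convex_convexHull ℝ S
      calc K ⊆ closure K := subset_closure
        _ = closure (interior K) :=
          (hconv.closure_interior_eq_closure_of_nonempty_interior hint).symm
        _ ⊆ A := closure_minimal (Set.sdiff_eq_empty.1 hopen) hAclosed
  · rintro (hint | hAeq)
    · have hK0 : μ K = 0 := by
        rw [← measure_interior_of_null_frontier ((convex_convexHull ℝ S).addHaar_frontier μ),
          hint, measure_empty]
      rw [hK0, nonpos_iff_eq_zero] at hBK
      rw [hBK, nonpos_iff_eq_zero.1 (hle.trans_eq hBK)]
    · exact le_antisymm (hBK.trans_eq (congrArg μ hAeq.symm)) hle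

end Monotonicity

theorem theorem1 :
    (∀ d k : ℕ, 2 ≤ d → max 2 ((d - 1) * (d - 2)) ≤ k →
      ∀ S : Set (EuclideanSpace ℝ (Fin d)), IsCompact S → IsStarShaped S →
        volume ((1 / ((k : ℝ) + 1)) • minkowskiMultiple S (k + 1))
            ≥ volume ((1 / (k : ℝ)) • minkowskiMultiple S k) ∧
          (volume ((1 / ((k : ℝ) + 1)) • minkowskiMultiple S (k + 1))
              = volume ((1 / (k : ℝ)) • minkowskiMultiple S k) ↔
            affineDim S < d ∨ (1 / (k : ℝ)) • minkowskiMultiple S k = convexHull ℝ S)) ∧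
    (∀ d : ℕ, d = 2 ∨ d = 3 →
      ∀ S : Set (EuclideanSpace ℝ (Fin d)), IsCompact S → IsStarShaped S →
        MonotoneOn (fun k : ℕ => volume ((1 / (k : ℝ)) • minkowskiMultiple S k)) (Set.Ici 1)) := by
  refine ⟨fun d k hd hk S hS hstar => ?_, fun d hd S hS hstar => ?_⟩
  · have hdim : Module.finrank ℝ (EuclideanSpace ℝ (Fin d)) = d := finrank_euclideanSpace_fin
    have h := hstar.measure_average_le_and_eq_iff volume hS (by rwa [hdim]) (k := k)
      (by rwa [hdim])
    rwa [hdim] at h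
  · have hdim : Module.finrank ℝ (EuclideanSpace ℝ (Fin d)) = d := finrank_euclideanSpace_fin
    intro m hm n _ hmn
    induction n, hmn using Nat.le_induction with
    | base => exact le_rfl
    | succ k hmk ih =>
      have hk1 : 1 ≤ k := le_trans hm hmk
      refine (ih hk1).trans ?_
      simp only [Nat.cast_add, Nat.cast_one]
      rcases hk1.eq_or_lt with rfl | hk2
      · have h1 : (1 / ((1 : ℕ) : ℝ)) • minkowskiMultiple S 1 = S := by
          rw [minkowskiMultiple_succ, minkowskiMultiple_zero]
          simp
        rw [h1]
        have h2 := subset_average (A := S) (two_ne_zero (α := ℕ))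
        exact measure_mono (by convert h2 using 2; norm_num)
      · refine (hstar.measure_average_le_and_eq_iff volume hS ?_ ?_).1
        · rw [hdim]; omega
        · rw [hdim]; rcases hd with rfl | rfl <;> exact max_le hk2 (by omega)
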